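/- An overpartition of $n$ is a non-increasing sequence of positive integers with sum $n$ in which the final occurrence of each integer may be overlined. For a part $\lambda$ let $\chi(\overline{\lambda})=1$ if $\lambda$ is overlined and $\chi(\overline{\lambda})=0$ otherwise; sums, differences and congruences of parts refer to their sizes. Let $\overline{\mathcal{C}'}(n;i,j)$ denote the number of jagged overpartitions of $n$, that is, sequences $(\lambda_1,\dots,\lambda_s)$, $s\ge 0$ (not necessarily monotone), of positive integers with sum $n$ in which the final occurrence of each integer may be overlined, with all parts not congruent to $3$ modulo $4$, such that $i$ (resp. $j$) parts are congruent to $1$ (resp. $2$) modulo $4$; the last part (if $s\ge1$) satisfies $\lambda_s\neq \overline{1},1,\overline{2},\overline{5}$; for all $1\le m<s$, $$\lambda_m-\lambda_{m+1}\ \ge\ \begin{cases}-2+4\chi(\overline{\lambda_m}) & \text{if } \lambda_m\equiv 0 \pmod 4 \text{ or } \lambda_m+\lambda_{m+1}\equiv 3 \pmod 4,\\ 4+4\chi(\overline{\lambda_m}) & \text{otherwise};\end{cases}$$ and, if the smallest part $x$ congruent to $0$ modulo $4$ exists and is equal to $4$ times the number of overlined parts which come after $x$ (with $x$ included), then the final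 part $\lambda_s$ is overlined. (If the smallest such value occurs more than once, this is required at every occurrence.) Let $\overline{\mathcal{D}'}(n;i,j)$ denote the number of overpartitions of $n$ whose overlined parts are not congruent to $3$ modulo $4$, which contain no part $\overline{1}$, and whose non-overlined parts are congruent to $0$, $3$ or $4$ modulo $8$, where $i$ is the number of parts congruent to $1$ modulo $4$ or $3$ modulo $8$ and $j$ is the number of parts congruent to $2$ modulo $4$ or $3$ modulo $8$. Then for all integers $n,i,j\ge 0$, $\overline{\mathcal{C}'}(n;i,j)=\overline{\mathcal{D}'}(n;i,j)$. -/

import Mathlib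

/-- A finite sequence of parts `(λ₁, …, λₛ)`, listed from left to right. The entry `(m, true)` is the
overlined part `m̄` and the entry `(m, false)` is the non-overlined part `m`. -/
abbrev OverSeq : Type := List (ℕ × Bool)

namespace OverSeq

/-- The integer of which the sequence is a jagged overpartition or an overpartition. -/
def size (l : OverSeq) : ℕ := (l.map Prod.fst).sum

/-- All parts are positive integers. -/
def PosParts (l : OverSeq) : Prop := ∀ p ∈ l, 0 < p.1

/-- Only the final occurrence of each integer may be overlined: an overlined part is followed by
no part (overlined or not) of the same size. -/
def OverlinedFinal (l : OverSeq) : Prop :=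
  l.Pairwise fun p p' => p.2 = true → p.1 ≠ p'.1

/-- An overpartition: a non-increasing sequence of positive integers in which the final occurrence
of each integer may be overlined. -/
def IsOverpartition (l : OverSeq) : Prop :=
  PosParts l ∧ l.Pairwise (fun p p' => p'.1 ≤ p.1) ∧ OverlinedFinal l

/-- `χ(p)`: it is `1` if the part is overlined and `0` otherwise. -/
def chi (p : ℕ × Bool) : ℤ := if p.2 = true then 1 else 0

/-- The minimal difference required between a part `p` and the part `p'` following it. -/
def minDiff (p p' : ℕ × Bool) : ℤ :=
  if p.1 % 4 = 0 ∨ (p.1 + p'.1) % 4 = 3 then -2 + 4 * chi p else 4 + 4 * chi p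

/-- The number of overlined parts of a sequence. -/
def numOverlined (l : OverSeq) : ℕ := l.countP fun p => p.2

/-- If the smallest part `x` congruent to `0` modulo `4` is equal to `4` times the number of overlined
parts which come after `x` (with `x` included), then the final part is overlined.
(When the smallest such size occurs several times, the condition is imposed at every occurrence.) -/
def SmallestCondition (l : OverSeq) : Prop :=
  ∀ (l₁ l₂ : OverSeq) (x : ℕ × Bool), l = l₁ ++ x :: l₂ →
    x.1 % 4 = 0 → (∀ y ∈ l, y.1 % 4 = 0 → x.1 ≤ y.1) →
    x.1 = 4 * numOverlined (x :: l₂) →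
    ∀ p ∈ l.getLast?, p.2 = true

/-- The jagged overpartitions into positive parts not congruent to `3` modulo `4` with the
required last part, consecutive differences, and smallest-multiple-of-`4` condition. -/
structure IsJagged (l : OverSeq) : Prop where
  pos : PosParts l
  overlinedFinal : OverlinedFinal l
  residue : ∀ p ∈ l, p.1 % 4 ≠ 3
  last : ∀ p ∈ l.getLast?, p ≠ (1, true) ∧ p ≠ (1, false) ∧ p ≠ (2, true) ∧ p ≠ (5, true)
  diff : l.IsChain fun p p' => minDiff p p' ≤ (p.1 : ℤ) - (p'.1 : ℤ)
  smallest : SmallestCondition l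

/-- The overpartitions with overlined parts not congruent to `3` modulo `4`, no part `1̄`, and
non-overlined parts congruent to `0`, `3` or `4` modulo `8`. -/
structure IsRestrictedOverpartition (l : OverSeq) : Prop where
  isOverpartition : IsOverpartition l
  overlined : ∀ p ∈ l, p.2 = true → p.1 % 4 ≠ 3
  no_one : (1, true) ∉ l
  nonOverlined : ∀ p ∈ l, p.2 = false → p.1 % 8 = 0 ∨ p.1 % 8 = 3 ∨ p.1 % 8 = 4

/-- The jagged overpartitions of `n` with `i` parts congruent to `1` and `j` parts congruent to `2`
modulo `4`. -/
def jaggedSet (n i j : ℕ) : Set OverSeq :=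
  {l | IsJagged l ∧ size l = n ∧
    (l.countP fun p => p.1 % 4 = 1) = i ∧ (l.countP fun p => p.1 % 4 = 2) = j}

/-- The restricted overpartitions of `n` with `i` parts congruent to `1` modulo `4` or `3` modulo
`8`, and `j` parts congruent to `2` modulo `4` or `3` modulo `8`. -/
def restrictedSet (n i j : ℕ) : Set OverSeq :=
  {l | IsRestrictedOverpartition l ∧ size l = n ∧
    (l.countP fun p => p.1 % 4 = 1 ∨ p.1 % 8 = 3) = i ∧
    (l.countP fun p => p.1 % 4 = 2 ∨ p.1 % 8 = 3) = j}

/-- There are finitely many sequences of positive parts of a given size, so that the cardinalities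
below are genuine. -/
theorem finite_posParts (n : ℕ) : {l : OverSeq | PosParts l ∧ size l = n}.Finite := by
  induction n using Nat.strong_induction_on with
  | _ n ih =>
    have hU : (⋃ k ∈ Set.Iio n, {l : OverSeq | PosParts l ∧ size l = k}).Finite :=
      (Set.finite_Iio n).biUnion fun k hk => ih k hk
    have hP : ((Set.Iic n) ×ˢ (Set.univ : Set Bool)).Finite :=
      (Set.finite_Iic n).prod Set.finite_univ
    refine ((Set.Finite.image2 List.cons hP hU).union (Set.finite_singleton [])).subset ?_
    rintro l ⟨hl, hs⟩
    cases l with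
    | nil => exact Or.inr rfl
    | cons p t =>
      have hp : 0 < p.1 := hl p (by simp)
      have hsum : p.1 + size t = n := by simpa [size] using hs
      refine Or.inl ⟨p, ⟨Set.mem_Iic.2 (by omega), trivial⟩, t, ?_, rfl⟩
      refine Set.mem_biUnion (x := size t) (Set.mem_Iio.2 (by omega)) ?_
      exact ⟨fun x hx => hl x (List.mem_cons_of_mem _ hx), rfl⟩

theorem finite_jaggedSet (n i j : ℕ) : (jaggedSet n i j).Finite :=
  (finite_posParts n).subset fun _ h => ⟨h.1.pos, h.2.1⟩

theorem finite_restrictedSet (n i j : ℕ) : (restrictedSet n i j).Finite :=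
  (finite_posParts n).subset fun _ h => ⟨h.1.isOverpartition.1, h.2.1⟩

/-- The number of jagged overpartitions in `jaggedSet n i j`. -/
noncomputable def jaggedCount (n i j : ℕ) : ℕ := (jaggedSet n i j).ncard

/-- The number of overpartitions in `restrictedSet n i j`. -/
noncomputable def restrictedCount (n i j : ℕ) : ℕ := (restrictedSet n i j).ncard

end OverSeq

/-! Each overlined part forces itself and all earlier parts up by 4. Subtracting from every part 4
times the number of overlined parts from it onwards (inverse of `lift`) cancels the `chi` terms in
the difference conditions (`minDiff_lift_iff`). What remains is a sequence `U` of sizes, constrained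
by `PartRel`, and a set `T` of overlined positions. An overline at position `m` costs exactly `4 *
m` (`size_lift_mark`), so `T` will become the overlined multiples of 4.

Within a block `4k, ..., 4k+3`, `PartRel` lets `U` run through copies of `4k` and then alternate
between `4k+2` and `4k+1`. The alternating run is an optional leading `4k+2`, then pairs `(4k+1,
4k+2)`, then an optional trailing `4k+1`. Coding these pieces by the tokens `4k+3`, `4k+2`, `4k+1`,
`4k` turns `U` into a decreasing list in which only odd tokens repeat, hence into a multiset
(`ncard_boundedPairs`). Token sums `4k`, `4k+2`, `8k+3`, `4k+1` are the remaining parts of the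
restricted overpartitions (`ncard_freePairs`).

The only link between `U` and `T` is that positions are at most the length of `U`, with the last
position in `T` when `U` contains a 0. Zeros (token 3) weigh nothing, and this rule determines their
number from `T` and the other tokens, so deleting them is a bijection onto unconstrained pairs
(`ncard_boundedPairs_eq_freePairs`). -/

namespace OverSeq

/-! ### Tokens and sequences of sizes -/

/-- The order on tokens: weakly decreasing, with even tokens not repeated. -/
def TokRel (a b : ℕ) : Prop := b < a ∨ (b = a ∧ a % 2 = 1)

/-- The relation between consecutive parts once overlining has been removed. -/
def PartRel (u v : ℕ) : Prop :=
  v / 4 < u / 4 ∨ (v / 4 = u / 4 ∧ (u % 4 = 0 ∨ (u + v) % 4 = 3))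

/-- The parts contributed by a token. -/
def expand (a : ℕ) : List ℕ :=
  if a % 4 = 3 then [a - 3] else if a % 4 = 2 then [a] else
  if a % 4 = 1 then [a, a + 1] else [a + 1]

/-- The token of a part that is not the first half of a pair. -/
def single (u : ℕ) : ℕ := if u % 4 = 0 then u + 3 else if u % 4 = 1 then u - 1 else u

/-- Recover the tokens from the parts. -/
def parse : List ℕ → List ℕ
  | [] => []
  | [u] => [single u]
  | u :: v :: t => if u % 4 = 1 ∧ v = u + 1 then u :: parse t else single u :: parse (v :: t)

theorem expand_single {u : ℕ} (hu : u % 4 ≠ 3) : expand (single u) = [u] := by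
  unfold expand single
  have : u % 4 = 0 ∨ u % 4 = 1 ∨ u % 4 = 2 := by omega
  rcases this with h | h | h
  · have h1 : (u + 3) % 4 = 3 := by omega
    simp [h, h1]
  · have h1 : (u - 1) % 4 = 0 := by omega
    have h2 : u - 1 + 1 = u := by omega
    simp [h, h1, h2]
  · simp [h]

theorem flatMap_expand_parse (U : List ℕ) (hU : ∀ u ∈ U, u % 4 ≠ 3) :
    (parse U).flatMap expand = U := by
  fun_induction parse U with
  | case1 => rfl
  | case2 u => simp [expand_single (hU u (by simp))]
  | case3 u v t h ih =>
    obtain ⟨h1, rfl⟩ := h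
    rw [List.flatMap_cons, ih fun w hw => hU w (by simp [hw])]
    simp [expand, h1]
  | case4 u v t h ih =>
    rw [List.flatMap_cons, ih fun w hw => hU w (List.mem_cons_of_mem _ hw),
      expand_single (hU u (by simp))]
    rfl

theorem head_parse {u : ℕ} {t : List ℕ} :
    ∀ a ∈ (parse (u :: t)).head?, a / 4 = u / 4 ∧ (u % 4 = 0 → a % 4 = 3) ∧
      (u % 4 = 2 → a % 4 = 2) ∧ (u % 4 = 1 → a % 4 ≤ 1) := by
  have key : ∀ a, a = u ∧ u % 4 = 1 ∨ a = single u → a / 4 = u / 4 ∧ (u % 4 = 0 → a % 4 = 3) ∧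
      (u % 4 = 2 → a % 4 = 2) ∧ (u % 4 = 1 → a % 4 ≤ 1) := by
    intro a ha
    unfold single at ha
    split_ifs at ha <;> omega
  intro a ha
  apply key
  cases t with
  | nil => simp [parse] at ha; simp [ha]
  | cons v t =>
    unfold parse at ha
    split_ifs at ha with h <;> simp at ha <;> simp [← ha, h]

theorem isChain_parse (U : List ℕ) (hU : ∀ u ∈ U, u % 4 ≠ 3) (hc : U.IsChain PartRel) :
    (parse U).IsChain TokRel := by
  fun_induction parse U with
  | case1 => simp
  | case2 u => simp
  | case3 u v t h ih =>
    obtain ⟨h1, rfl⟩ := h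
    simp only [List.isChain_cons] at hc ⊢
    refine ⟨fun a ha => ?_, ih (fun w hw => hU w (by simp [hw])) hc.2.2⟩
    cases t with
    | nil => simp [parse] at ha
    | cons w t =>
      have h2 := head_parse a ha
      have h3 := hc.2.1 w (by simp)
      unfold PartRel at h3
      unfold TokRel
      omega
  | case4 u v t h ih =>
    rw [List.isChain_cons] at hc ⊢
    refine ⟨fun a ha => ?_, ih (fun w hw => hU w (List.mem_cons_of_mem _ hw)) hc.2⟩
    have h2 := head_parse a ha
    have h3 := hc.1 v (by simp)
    have h4 := hU u (by simp)
    have h5 := hU v (by simp)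
    unfold PartRel at h3
    unfold TokRel single
    split_ifs <;> omega

theorem parse_cons_of_not {u : ℕ} {t : List ℕ} (h : ∀ v ∈ t.head?, ¬(u % 4 = 1 ∧ v = u + 1)) :
    parse (u :: t) = single u :: parse t := by
  cases t with
  | nil => simp [parse]
  | cons v t => rw [parse, if_neg (h v (by simp))]

theorem head_flatMap_expand (V : List ℕ) :
    ∀ u ∈ (V.flatMap expand).head?, ∃ a ∈ V.head?, u / 4 = a / 4 ∧ (a % 4 = 3 → u % 4 = 0) ∧
      (a % 4 = 2 → u % 4 = 2) ∧ (a % 4 ≤ 1 → u % 4 = 1) := by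
  intro u hu
  cases V with
  | nil => simp at hu
  | cons a V =>
    refine ⟨a, by simp, ?_⟩
    simp only [List.flatMap_cons, expand] at hu
    split_ifs at hu <;> simp at hu <;> omega

/-- Greedy pairing is unambiguous because an even token `4k` does not repeat: the part after its
`4k+1` lies in a lower block and cannot be mistaken for the second half of a pair. -/
theorem parse_flatMap_expand (V : List ℕ) (hV : V.IsChain TokRel) :
    parse (V.flatMap expand) = V := by
  induction V with
  | nil => rfl
  | cons a V ih =>
    rw [List.isChain_cons] at hV
    have ih := ih hV.2
    rw [List.flatMap_cons]
    have hh : ∀ v ∈ (V.flatMap expand).head?, ¬ (a % 4 = 0 ∧ v = a + 1 + 1) := by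
      intro v hv
      obtain ⟨b, hb, h1⟩ := head_flatMap_expand V v hv
      have h2 := hV.1 b hb
      unfold TokRel at h2
      omega
    have h4 : a % 4 = 3 ∨ a % 4 = 2 ∨ a % 4 = 1 ∨ a % 4 = 0 := by omega
    rcases h4 with h | h | h | h
    · have h1 : expand a = [a - 3] := by simp [expand, h]
      rw [h1, List.singleton_append, parse_cons_of_not (fun v _ => by omega), ih]
      congr 1
      unfold single
      split_ifs <;> omega
    · have h1 : expand a = [a] := by simp [expand, h]
      rw [h1, List.singleton_append, parse_cons_of_not (fun v _ => by omega), ih]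
      congr 1
      unfold single
      split_ifs <;> omega
    · have h1 : expand a = [a, a + 1] := by simp [expand, h]
      rw [h1, List.cons_append, List.singleton_append, parse, if_pos ⟨h, rfl⟩, ih]
    · have h1 : expand a = [a + 1] := by simp [expand, h]
      rw [h1, List.singleton_append,
        parse_cons_of_not (fun v hv hc => hh v hv ⟨h, hc.2⟩), ih]
      congr 1
      unfold single
      split_ifs <;> omega

theorem isChain_flatMap_expand (V : List ℕ) (hV : V.IsChain TokRel) :
    (V.flatMap expand).IsChain PartRel := by
  induction V with
  | nil => simp
  | cons a V ih =>
    rw [List.isChain_cons] at hV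
    have ih := ih hV.2
    rw [List.flatMap_cons]
    have hh : ∀ v ∈ (V.flatMap expand).head?, ∃ b, TokRel a b ∧ v / 4 = b / 4 ∧
        (b % 4 = 3 → v % 4 = 0) ∧ (b % 4 = 2 → v % 4 = 2) ∧ (b % 4 ≤ 1 → v % 4 = 1) := by
      intro v hv
      obtain ⟨b, hb, h1⟩ := head_flatMap_expand V v hv
      exact ⟨b, hV.1 b hb, h1⟩
    unfold expand
    split_ifs with h1 h2 h3
    all_goals
      simp only [List.cons_append, List.nil_append, List.isChain_cons]
    · refine ⟨fun v hv => ?_, ih⟩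
      obtain ⟨b, hb, h⟩ := hh v hv
      unfold TokRel at hb; unfold PartRel; omega
    · refine ⟨fun v hv => ?_, ih⟩
      obtain ⟨b, hb, h⟩ := hh v hv
      unfold TokRel at hb; unfold PartRel; omega
    · refine ⟨fun v hv => ?_, fun v hv => ?_, ih⟩
      · simp at hv; subst hv; unfold PartRel; omega
      obtain ⟨b, hb, h⟩ := hh v hv
      unfold TokRel at hb; unfold PartRel; omega
    · refine ⟨fun v hv => ?_, ih⟩
      obtain ⟨b, hb, h⟩ := hh v hv
      unfold TokRel at hb; unfold PartRel; omega

theorem mod_four_of_mem_flatMap_expand {V : List ℕ} {u : ℕ} (hu : u ∈ V.flatMap expand) :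
    u % 4 ≠ 3 := by
  rw [List.mem_flatMap] at hu
  obtain ⟨a, -, ha⟩ := hu
  unfold expand at ha
  split_ifs at ha <;> simp at ha <;> omega

theorem zero_mem_flatMap_expand {V : List ℕ} : 0 ∈ V.flatMap expand ↔ 3 ∈ V := by
  have h : ∀ a, 0 ∈ expand a ↔ a = 3 := by
    intro a
    unfold expand
    split_ifs <;> simp <;> omega
  simp [List.mem_flatMap, h]

instance : Trans TokRel TokRel TokRel where
  trans {a b c} h1 h2 := by unfold TokRel at *; omega

/-- Token 0 is minimal and unrepeated, so it can only be last; no other token has an expansion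
ending in 1. -/
theorem getLast_flatMap_expand_ne_one {V : List ℕ} (hV : V.IsChain TokRel) :
    (∀ u ∈ (V.flatMap expand).getLast?, u ≠ 1) ↔ 0 ∉ V := by
  constructor
  · intro h h0
    obtain ⟨V₁, V₂, rfl⟩ := List.append_of_mem h0
    rw [List.isChain_iff_pairwise, List.pairwise_append] at hV
    have h2 : V₂ = [] := by
      rw [List.eq_nil_iff_forall_not_mem]
      intro b hb
      have := List.rel_of_pairwise_cons hV.2.1 hb
      unfold TokRel at this
      omega
    subst h2
    exact h 1 (by simp [expand]) rfl
  · intro h u hu h1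
    subst h1
    have hne : V ≠ [] := by rintro rfl; simp at hu
    rw [← List.dropLast_append_getLast hne, List.flatMap_append] at hu
    have hm0 := List.getLast_mem hne
    generalize V.getLast hne = a at *
    have ha : a ≠ 0 := by rintro rfl; exact h hm0
    simp only [List.flatMap_singleton, expand] at hu
    split_ifs at hu <;> simp at hu <;> omega

/-! ### Separating the overlines from the sizes -/

/-- Increase each part by four times the number of overlined parts from it onwards. -/
def lift : OverSeq → OverSeq
  | [] => []
  | p :: t => (p.1 + 4 * numOverlined (p :: t), p.2) :: lift t

/-- Decrease each part by four times the number of overlined parts from it onwards. -/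
def unlift : OverSeq → OverSeq
  | [] => []
  | p :: t => (p.1 - 4 * numOverlined (p :: t), p.2) :: unlift t

theorem numOverlined_cons (p : ℕ × Bool) (t : OverSeq) :
    numOverlined (p :: t) = p.2.toNat + numOverlined t := by
  rcases p with ⟨n, _ | _⟩ <;> simp [numOverlined, add_comm]

theorem map_snd_lift (W : OverSeq) : (lift W).map Prod.snd = W.map Prod.snd := by
  induction W with
  | nil => rfl
  | cons p t ih => simp [lift, ih]

theorem map_mod_lift (W : OverSeq) :
    (lift W).map (fun p => p.1 % 4) = W.map (fun p => p.1 % 4) := by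
  induction W with
  | nil => rfl
  | cons p t ih => simp [lift, ih]

theorem countP_mod_lift (W : OverSeq) (c : ℕ) :
    (lift W).countP (fun p => p.1 % 4 = c) = W.countP (fun p => p.1 % 4 = c) := by
  have h := congrArg (List.countP (fun m => decide (m = c))) (map_mod_lift W)
  simpa only [List.countP_map, Function.comp_def] using h

theorem unlift_lift (W : OverSeq) : unlift (lift W) = W := by
  induction W with
  | nil => rfl
  | cons p t ih =>
    have h : ∀ l : OverSeq, numOverlined l = (l.map Prod.snd).count true := by
      intro l
      rw [numOverlined, List.count, List.countP_map]
      congr 1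
      funext p
      simp
    have h1 : numOverlined ((p.1 + 4 * numOverlined (p :: t), p.2) :: lift t) =
        numOverlined (p :: t) := by
      rw [h, h]; simp [map_snd_lift]
    rw [lift, unlift, h1, ih]
    simp

theorem numOverlined_lift (W : OverSeq) : numOverlined (lift W) = numOverlined W := by
  induction W with
  | nil => rfl
  | cons p t ih => rw [lift, numOverlined_cons, numOverlined_cons, ih]

theorem numOverlined_unlift (W : OverSeq) : numOverlined (unlift W) = numOverlined W := by
  induction W with
  | nil => rfl
  | cons p t ih => rw [unlift, numOverlined_cons, numOverlined_cons, ih]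

theorem head_lift (W : OverSeq) :
    (lift W).head? = W.head?.map fun q => (q.1 + 4 * numOverlined W, q.2) := by
  cases W <;> simp [lift]

theorem getLast_lift (W : OverSeq) :
    (lift W).getLast? = W.getLast?.map fun q => (q.1 + 4 * q.2.toNat, q.2) := by
  induction W with
  | nil => rfl
  | cons p t ih =>
    cases t with
    | nil => rcases p with ⟨n, _ | _⟩ <;> simp [lift, numOverlined]
    | cons q t =>
      rw [lift, List.getLast?_cons, ih, List.getLast?_cons]
      simp [List.getLast?_cons]

theorem isChain_lift_iff {A B : ℕ × Bool → ℕ × Bool → Prop} (W : OverSeq)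
    (hW : ∀ p ∈ W, p.1 % 4 ≠ 3)
    (h : ∀ p q : ℕ × Bool, ∀ o, p.1 % 4 ≠ 3 → q.1 % 4 ≠ 3 →
      (A (p.1 + 4 * (p.2.toNat + o), p.2) (q.1 + 4 * o, q.2) ↔ B p q)) :
    (lift W).IsChain A ↔ W.IsChain B := by
  induction W with
  | nil => simp [lift]
  | cons p t ih =>
    rw [lift, List.isChain_cons, List.isChain_cons,
      ih fun q hq => hW q (List.mem_cons_of_mem _ hq), head_lift]
    refine and_congr_left fun _ => ?_
    cases t with
    | nil => simp
    | cons q t =>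
      simp only [List.head?_cons, Option.map_some, Option.mem_def, Option.some.injEq,
        forall_eq']
      rw [numOverlined_cons p]
      exact h p q _ (hW p (by simp)) (hW q (by simp))

/-- The lift adds `4 * chi p` to the difference, which cancels against `minDiff`. The bounds `-2`
and `4` that remain become comparisons of quotients by 4 since residue 3 is excluded. -/
theorem minDiff_lift_iff (p q : ℕ × Bool) (o : ℕ) (hp : p.1 % 4 ≠ 3) (hq : q.1 % 4 ≠ 3) :
    minDiff (p.1 + 4 * (p.2.toNat + o), p.2) (q.1 + 4 * o, q.2) ≤
      ((p.1 + 4 * (p.2.toNat + o) : ℕ) : ℤ) - ((q.1 + 4 * o : ℕ) : ℤ) ↔ PartRel p.1 q.1 := by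
  rcases p with ⟨p, _ | _⟩ <;> simp only [minDiff, chi, PartRel, Bool.toNat] at * <;>
    split_ifs <;> simp at * <;> omega

/-- The sequences with overlining removed from the sizes of the parts. -/
structure IsBase (W : OverSeq) : Prop where
  residue : ∀ p ∈ W, p.1 % 4 ≠ 3
  chain : W.IsChain fun p q => PartRel p.1 q.1
  last : ∀ p ∈ W.getLast?, p.1 ≠ 1
  zero : (∃ p ∈ W, p.1 = 0) → ∀ p ∈ W.getLast?, p.2 = true

theorem lift_append (W₁ W₂ : OverSeq) :
    ∃ L, lift (W₁ ++ W₂) = L ++ lift W₂ ∧ ∀ y ∈ L, 4 * numOverlined W₂ ≤ y.1 := by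
  induction W₁ with
  | nil => exact ⟨[], rfl, by simp⟩
  | cons p t ih =>
    obtain ⟨L, h1, h2⟩ := ih
    refine ⟨(p.1 + 4 * numOverlined (p :: (t ++ W₂)), p.2) :: L, by simp [lift, h1], ?_⟩
    intro y hy
    rcases List.mem_cons.1 hy with rfl | hy
    · have : numOverlined W₂ ≤ numOverlined (p :: (t ++ W₂)) := by
        simp only [numOverlined]
        exact List.Sublist.countP_le
          ((List.sublist_append_right t W₂).trans (List.sublist_cons_self _ _))
      simp only
      omega
    · exact h2 y hy

theorem eq_append_of_lift_eq {W l₁ l₂ : OverSeq} {x : ℕ × Bool} (h : lift W = l₁ ++ x :: l₂) :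
    ∃ q ∈ W, x.1 = q.1 + 4 * numOverlined (x :: l₂) := by
  induction W generalizing l₁ with
  | nil => simp [lift] at h
  | cons p t ih =>
    cases l₁ with
    | nil =>
      rw [← List.nil_append (x :: l₂), ← h, numOverlined_lift]
      simp only [lift, List.nil_append, List.cons.injEq] at h
      exact ⟨p, by simp, by rw [← h.1]⟩
    | cons y l₁ =>
      simp only [lift, List.cons_append, List.cons.injEq] at h
      obtain ⟨q, hq, h1⟩ := ih h.2
      exact ⟨q, List.mem_cons_of_mem _ hq, h1⟩

theorem exists_last_zero {W : OverSeq} (h : ∃ p ∈ W, p.1 = 0) :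
    ∃ W₁ q W₂, W = W₁ ++ q :: W₂ ∧ q.1 = 0 ∧ ∀ p ∈ W₂, p.1 ≠ 0 := by
  induction W with
  | nil => simp at h
  | cons p t ih =>
    by_cases ht : ∃ p ∈ t, p.1 = 0
    · obtain ⟨W₁, q, W₂, rfl, h1, h2⟩ := ih ht
      exact ⟨p :: W₁, q, W₂, rfl, h1, h2⟩
    · push Not at ht
      refine ⟨[], p, t, rfl, ?_, ht⟩
      obtain ⟨q, hq, h0⟩ := h
      rcases List.mem_cons.1 hq with rfl | hq
      · exact h0
      · exact absurd h0 (ht q hq)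

theorem mod_of_mem_lift {W : OverSeq} {p : ℕ × Bool} (hp : p ∈ lift W) :
    ∃ q ∈ W, p.1 % 4 = q.1 % 4 := by
  have h : p.1 % 4 ∈ (lift W).map (fun p => p.1 % 4) := List.mem_map_of_mem hp
  rw [map_mod_lift, List.mem_map] at h
  obtain ⟨q, hq, h⟩ := h
  exact ⟨q, hq, h.symm⟩

theorem mod_lift_of_mem {W : OverSeq} {p : ℕ × Bool} (hp : p ∈ W) :
    ∃ q ∈ lift W, p.1 % 4 = q.1 % 4 := by
  have h : p.1 % 4 ∈ W.map (fun p => p.1 % 4) := List.mem_map_of_mem hp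
  rw [← map_mod_lift, List.mem_map] at h
  obtain ⟨q, hq, h⟩ := h
  exact ⟨q, hq, h.symm⟩

theorem isJagged_lift {W : OverSeq} (hW : IsBase W) : IsJagged (lift W) := by
  have hlast : ∀ p ∈ (lift W).getLast?, ∃ q ∈ W.getLast?, (q.1 + 4 * q.2.toNat, q.2) = p := by
    intro p hp
    rw [getLast_lift] at hp
    simpa using hp
  have hzero : (∃ p ∈ W, p.1 = 0) → ∀ p ∈ (lift W).getLast?, p.2 = true := by
    intro h p hp
    obtain ⟨q, hq, rfl⟩ := hlast p hp
    exact hW.zero h q hq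
  refine ⟨?_, ?_, ?_, ?_, ?_, ?_⟩
  · intro p hp
    obtain ⟨l₁, l₂, h⟩ := List.append_of_mem hp
    obtain ⟨q, hq, h1⟩ := eq_append_of_lift_eq h
    -- A base part 0 lifts to a positive part because the last part is then overlined and is counted
    -- in the lift.
    by_cases h0 : q.1 = 0
    · have hne : lift W ≠ [] := by rw [h]; simp
      have hl := hzero ⟨q, hq, h0⟩ _ (List.getLast?_eq_getLast_of_ne_nil hne)
      have hpos : 0 < numOverlined (p :: l₂) := by
        rw [numOverlined, List.countP_pos_iff]
        refine ⟨_, ?_, hl⟩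
        have := List.getLast_append_right (l := l₁) (l' := p :: l₂) (by simp)
        simp only [h]
        rw [this]
        exact List.getLast_mem _
      omega
    · omega
  -- After lifting, quotients by 4 decrease weakly, and strictly after an overlined part; this
  -- relation is transitive, so it passes from neighbours to all pairs.
  · let S : ℕ × Bool → ℕ × Bool → Prop := fun p q => q.1 / 4 + p.2.toNat ≤ p.1 / 4
    have : Trans S S S := ⟨fun {a b c} h1 h2 => by simp only [S] at *; omega⟩
    have hS : (lift W).IsChain S := by
      rw [isChain_lift_iff (B := fun p q => q.1 / 4 ≤ p.1 / 4) W hW.residue]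
      · exact hW.chain.imp fun p q h => by unfold PartRel at h; omega
      · intro p q o _ _
        simp only [S]
        omega
    rw [List.isChain_iff_pairwise] at hS
    refine hS.imp fun {p q} h hp => ?_
    simp only [S, hp, Bool.toNat_true] at h
    omega
  · intro p hp
    obtain ⟨q, hq, h⟩ := mod_of_mem_lift hp
    rw [h]
    exact hW.residue q hq
  · intro p hp
    obtain ⟨⟨n, b⟩, hq, rfl⟩ := hlast p hp
    have h1 := hW.last _ hq
    rcases b with _ | _ <;> simp at h1 ⊢ <;> omega
  · rw [isChain_lift_iff W hW.residue]
    · exact hW.chain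
    · intro p q o hp hq
      exact minDiff_lift_iff p q o hp hq
  -- Equality with 4 times the overline count says that the base part is 0.
  · intro l₁ l₂ x h hx _ hx2
    obtain ⟨q, hq, h1⟩ := eq_append_of_lift_eq h
    exact hzero ⟨q, hq, by omega⟩

theorem isBase_of_isJagged_lift {W : OverSeq} (hW : IsJagged (lift W)) : IsBase W := by
  have hlast : ∀ q ∈ W.getLast?, (q.1 + 4 * q.2.toNat, q.2) ∈ (lift W).getLast? := by
    intro q hq
    rw [getLast_lift, Option.mem_def.1 hq]
    rfl
  have hres : ∀ p ∈ W, p.1 % 4 ≠ 3 := by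
    intro p hp
    obtain ⟨q, hq, h⟩ := mod_lift_of_mem hp
    rw [h]
    exact hW.residue q hq
  have hch : W.IsChain fun p q => PartRel p.1 q.1 := by
    have h := hW.diff
    rwa [isChain_lift_iff W hres] at h
    intro p q o hp hq
    exact minDiff_lift_iff p q o hp hq
  refine ⟨hres, hch, ?_, ?_⟩
  · rintro ⟨n, b⟩ hp h1
    have := hW.last _ (hlast _ hp)
    simp only at h1
    subst h1
    rcases b with _ | _ <;> simp at this
  · intro h p hp
    -- The last 0 lifts to the smallest multiple of 4: earlier parts gain at least as much, and
    -- later base parts lie in block 0 without being 0, so they are 1 or 2.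
    obtain ⟨W₁, q, W₂, rfl, h0, h2⟩ := exists_last_zero h
    obtain ⟨L, hL, hL2⟩ := lift_append W₁ (q :: W₂)
    change (p.1 + 4 * p.2.toNat, p.2).2 = true
    refine hW.smallest L (lift W₂) _ hL (by rw [h0]; omega) ?_ ?_ _ (hlast p hp)
    · intro y hy hy4
      rw [hL, lift] at hy
      rcases List.mem_append.1 hy with hy | hy
      · simpa [h0] using hL2 y hy
      · rcases List.mem_cons.1 hy with rfl | hy
        · exact le_rfl
        · obtain ⟨z, hz, hz4⟩ := mod_of_mem_lift hy
          have hz0 := h2 z hz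
          have hzr := hres z (by simp [hz])
          let S : ℕ × Bool → ℕ × Bool → Prop := fun p q => q.1 / 4 ≤ p.1 / 4
          have : Trans S S S := ⟨fun {a b c} h1 h2 => by simp only [S] at *; omega⟩
          have hS : (W₁ ++ q :: W₂).IsChain S :=
            hch.imp fun p q h => by unfold PartRel at h; simp only [S]; omega
          rw [List.isChain_iff_pairwise, List.pairwise_append] at hS
          have := List.rel_of_pairwise_cons hS.2.1 hz
          simp only [S] at this
          omega
    · have := numOverlined_lift (q :: W₂)
      rw [lift] at this
      rw [this, h0]
      simp

theorem lift_unlift_of_isJagged {l : OverSeq} (hl : IsJagged l) : lift (unlift l) = l := by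
  -- Natural subtraction in `unlift` must not truncate; the bound on the head is carried by
  -- induction from the right end. In the cases allowing a rise of up to 2, the residues restore the
  -- multiple of 4.
  have key : ∀ l : OverSeq, (∀ p ∈ l, p.1 % 4 ≠ 3) →
      (∀ p ∈ l.getLast?, p.2 = true → 4 ≤ p.1) →
      (l.IsChain fun p p' => minDiff p p' ≤ (p.1 : ℤ) - (p'.1 : ℤ)) →
      (∀ p ∈ l.head?, 4 * numOverlined l ≤ p.1) ∧ lift (unlift l) = l := by
    intro l
    induction l with
    | nil => intro _ _ _; exact ⟨by simp, rfl⟩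
    | cons p t ih =>
      intro h1 h2 h3
      have hle : 4 * numOverlined (p :: t) ≤ p.1 ∧ lift (unlift t) = t := by
        cases t with
        | nil =>
          have := h2 p (by simp)
          refine ⟨?_, rfl⟩
          rcases p with ⟨n, _ | _⟩ <;> simp [numOverlined] at this ⊢
          exact this
        | cons q t =>
          rw [List.isChain_cons_cons] at h3
          obtain ⟨h4, h5⟩ := ih (fun p hp => h1 p (List.mem_cons_of_mem _ hp))
            (fun p hp => h2 p (by
              rw [List.getLast?_cons_cons]
              exact hp)) h3.2
          refine ⟨?_, h5⟩
          have h4 := h4 q (by simp)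
          have h6 := h3.1
          have h7 := h1 p (by simp)
          have h8 := h1 q (by simp)
          rw [numOverlined_cons]
          generalize numOverlined (q :: t) = o at *
          rcases p with ⟨p, _ | _⟩ <;> simp only [minDiff, chi, Bool.toNat] at * <;>
            split_ifs at h6 <;> simp at * <;> omega
      refine ⟨by simpa using hle.1, ?_⟩
      have h9 := numOverlined_unlift (p :: t)
      rw [unlift] at h9
      rw [unlift, lift, h9, hle.2]
      simp only [List.cons.injEq, and_true]
      ext
      · simp only; omega
      · rfl
  refine (key l hl.residue ?_ hl.diff).2
  -- An overlined last part of size 1 or 2 is forbidden by `last`, and size 3 by `residue`.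
  rintro ⟨n, b⟩ hp hb
  have h1 := hl.last _ hp
  have h2 := hl.residue _ (List.mem_of_getLast? hp)
  have h3 := hl.pos _ (List.mem_of_getLast? hp)
  simp only at hb h2 h3
  subst hb
  simp at h1
  simp only
  omega

/-! ### Token lists as multisets -/

theorem eq_of_perm_of_isChain {V V' : List ℕ} (h : V.IsChain TokRel) (h' : V'.IsChain TokRel)
    (hp : V.Perm V') : V = V' := by
  rw [List.isChain_iff_pairwise] at h h'
  refine hp.eq_of_pairwise (fun a b _ _ h1 h2 => ?_) h h'
  unfold TokRel at h1 h2
  omega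

theorem count_le_one_of_isChain {V : List ℕ} (h : V.IsChain TokRel) {a : ℕ} (ha : a % 2 = 0) :
    V.count a ≤ 1 := by
  rw [List.isChain_iff_pairwise] at h
  induction V with
  | nil => simp
  | cons b V ih =>
    rw [List.pairwise_cons] at h
    by_cases hb : b = a
    · subst hb
      have : V.count b = 0 := by
        rw [List.count_eq_zero]
        intro hm
        have := h.1 b hm
        unfold TokRel at this
        omega
      simp [this]
    · rw [List.count_cons_of_ne hb]
      exact ih h.2

theorem isChain_sort {M : Multiset ℕ} (hM : ∀ a, a % 2 = 0 → M.count a ≤ 1) :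
    (M.sort (· ≥ ·)).IsChain TokRel := by
  have h1 := M.pairwise_sort (· ≥ ·)
  rw [← M.sort_eq (· ≥ ·)] at hM
  generalize M.sort (· ≥ ·) = V at *
  rw [List.isChain_iff_pairwise]
  simp only [Multiset.coe_count] at hM
  induction V with
  | nil => simp
  | cons b V ih =>
    rw [List.pairwise_cons] at h1 ⊢
    refine ⟨fun c hc => ?_, ih h1.2 fun a ha => ?_⟩
    · have h2 := h1.1 c hc
      rcases Nat.lt_or_ge c b with h3 | h3
      · exact Or.inl h3
      · have h4 : c = b := le_antisymm h2 h3
        subst h4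
        refine Or.inr ⟨rfl, ?_⟩
        by_contra h5
        have h6 := hM c (by omega)
        have h7 := List.count_pos_iff.2 hc
        rw [List.count_cons_self] at h6
        omega
    · exact (List.count_le_count_cons).trans (hM a ha)

theorem sort_coe_of_isChain {V : List ℕ} (h : V.IsChain TokRel) :
    (V : Multiset ℕ).sort (· ≥ ·) = V := by
  refine eq_of_perm_of_isChain (isChain_sort fun a ha => ?_) h ?_
  · rw [Multiset.coe_count]
    exact count_le_one_of_isChain h ha
  · rw [← Multiset.coe_eq_coe, Multiset.sort_eq]

/-! ### Overlines as a set of positions -/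

/-- Overline the parts whose (one-based) position belongs to `T`. -/
def mark (T : Finset ℕ) (U : List ℕ) : OverSeq := U.mapIdx fun i u => (u, decide (i + 1 ∈ T))

theorem map_fst_mark (T : Finset ℕ) (U : List ℕ) : (mark T U).map Prod.fst = U := by
  apply List.ext_getElem?
  intro i
  simp [mark, Function.comp_def]

theorem length_mark (T : Finset ℕ) (U : List ℕ) : (mark T U).length = U.length := by
  simp [mark]

theorem isBase_mark {T : Finset ℕ} {U : List ℕ} : IsBase (mark T U) ↔
    (∀ u ∈ U, u % 4 ≠ 3) ∧ U.IsChain PartRel ∧ (∀ u ∈ U.getLast?, u ≠ 1) ∧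
      (0 ∈ U → U.length ∈ T) := by
  have hres : (∀ u ∈ U, u % 4 ≠ 3) ↔ ∀ p ∈ mark T U, p.1 % 4 ≠ 3 := by
    conv_lhs => rw [← map_fst_mark T U]
    rw [List.forall_mem_map]
  have hch : U.IsChain PartRel ↔ (mark T U).IsChain fun p q => PartRel p.1 q.1 := by
    conv_lhs => rw [← map_fst_mark T U]
    rw [List.isChain_map]
  have hlast : (mark T U).getLast? =
      U.getLast?.map fun u => (u, decide (U.length - 1 + 1 ∈ T)) := by
    simp [mark]
  have hz : (∃ p ∈ mark T U, p.1 = 0) ↔ 0 ∈ U := by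
    conv_rhs => rw [← map_fst_mark T U]
    simp only [List.mem_map]
  constructor
  · intro h
    refine ⟨hres.2 h.residue, hch.2 h.chain, fun u hu => ?_, fun h0 => ?_⟩
    · refine h.last (u, decide (U.length - 1 + 1 ∈ T)) ?_
      rw [hlast, Option.mem_def.1 hu]
      rfl
    · have hne : U ≠ [] := List.ne_nil_of_mem h0
      have h1 := h.zero (hz.2 h0) (U.getLast hne, decide (U.length - 1 + 1 ∈ T)) (by
        rw [hlast, List.getLast?_eq_getLast_of_ne_nil hne]
        rfl)
      have h2 := List.length_pos_of_ne_nil hne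
      rw [Nat.sub_add_cancel h2] at h1
      simpa using h1
  · rintro ⟨h1, h2, h3, h4⟩
    refine ⟨hres.1 h1, hch.1 h2, ?_, ?_⟩
    · intro p hp
      rw [hlast] at hp
      obtain ⟨u, hu, rfl⟩ := by simpa using hp
      exact h3 u hu
    · intro h p hp
      rw [hlast] at hp
      have h0 := hz.1 h
      have hne : U ≠ [] := List.ne_nil_of_mem h0
      have h5 := List.length_pos_of_ne_nil hne
      obtain ⟨u, hu, rfl⟩ := by simpa using hp
      simpa [Nat.sub_add_cancel h5] using h4 h0

theorem exists_mark_eq (W : OverSeq) :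
    ∃ T : Finset ℕ, (0 ∉ T ∧ ∀ m ∈ T, m ≤ W.length) ∧ mark T (W.map Prod.fst) = W := by
  refine ⟨((Finset.range W.length).filter fun i => W[i]?.map Prod.snd = some true).image
    (· + 1), ⟨by simp, ?_⟩, ?_⟩
  · intro m hm
    simp only [Finset.mem_image, Finset.mem_filter, Finset.mem_range] at hm
    omega
  · apply List.ext_getElem
    · simp [length_mark]
    · intro i h1 h2
      ext
      · simp [mark]
      · rw [Bool.eq_iff_iff]
        simp only [mark, List.getElem_mapIdx, decide_eq_true_eq, Finset.mem_image,
          Finset.mem_filter, Finset.mem_range, Option.map_eq_some_iff]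
        constructor
        · rintro ⟨k, ⟨hk, q, hq, h3⟩, h4⟩
          obtain rfl : k = i := by omega
          rw [List.getElem?_eq_getElem hk, Option.some.injEq] at hq
          rw [hq, h3]
        · exact fun h3 => ⟨i, ⟨h2, W[i], List.getElem?_eq_getElem h2, h3⟩, rfl⟩

theorem mark_injective {T T' : Finset ℕ} {U U' : List ℕ} (h0 : 0 ∉ T) (h0' : 0 ∉ T')
    (hT : ∀ m ∈ T, m ≤ U.length) (hT' : ∀ m ∈ T', m ≤ U'.length)
    (h : mark T U = mark T' U') : U = U' ∧ T = T' := by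
  have hU : U = U' := by rw [← map_fst_mark T U, h, map_fst_mark]
  subst hU
  refine ⟨rfl, ?_⟩
  ext m
  cases m with
  | zero => simp [h0, h0']
  | succ i =>
    by_cases hi : i < U.length
    · have := congrArg (fun W : OverSeq => W[i]?) h
      simpa [mark, hi] using this
    · constructor
      · intro hm; have := hT _ hm; omega
      · intro hm; have := hT' _ hm; omega

/-- The sum over all suffixes of the number of overlined parts. -/
def suffixSum : List Bool → ℕ
  | [] => 0
  | b :: t => (b :: t).count true + suffixSum t

theorem suffixSum_concat (bs : List Bool) (b : Bool) :
    suffixSum (bs ++ [b]) = suffixSum bs + if b then bs.length + 1 else 0 := by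
  induction bs with
  | nil => cases b <;> rfl
  | cons c t ih =>
    simp only [List.cons_append, suffixSum, ih, List.count_cons, List.count_append,
      List.length_cons]
    cases b <;> simp; omega

theorem size_lift (W : OverSeq) : size (lift W) = size W + 4 * suffixSum (W.map Prod.snd) := by
  induction W with
  | nil => rfl
  | cons p t ih =>
    have h : numOverlined (p :: t) = ((p :: t).map Prod.snd).count true := by
      rw [numOverlined, List.count, List.countP_map]
      congr 1
      funext p
      simp
    simp only [size, lift, List.map_cons, List.sum_cons, suffixSum] at ih ⊢
    rw [ih, h, List.map_cons]
    ring

/-- Double counting: the overline at one-based position `m` belongs to exactly the `m` suffixes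
starting at or before it. -/
theorem suffixSum_mark (T : Finset ℕ) (U : List ℕ) : suffixSum ((mark T U).map Prod.snd) =
    ∑ m ∈ Finset.range (U.length + 1), if m ∈ T then m else 0 := by
  induction U using List.reverseRecOn with
  | nil => simp [mark, suffixSum, -Finset.sum_ite_mem]
  | append_singleton U u ih =>
    have h : (mark T (U ++ [u])).map Prod.snd =
        (mark T U).map Prod.snd ++ [decide (U.length + 1 ∈ T)] := by
      simp [mark]
    rw [h, suffixSum_concat, ih, List.length_append, List.length_singleton,
      Finset.sum_range_succ _ (U.length + 1)]
    simp [length_mark]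

theorem size_lift_mark {T : Finset ℕ} {U : List ℕ} (hT : ∀ m ∈ T, m ≤ U.length) :
    size (lift (mark T U)) = U.sum + 4 * ∑ m ∈ T, m := by
  rw [size_lift, suffixSum_mark, size, map_fst_mark, ← Finset.sum_filter]
  congr 3
  ext m
  simp only [Finset.mem_filter, Finset.mem_range]
  exact ⟨fun h => h.2, fun h => ⟨by have := hT m h; omega, h⟩⟩

/-! ### Jagged overpartitions as token pairs -/

/-- The number of parts contributed by a multiset of tokens. -/
def numParts (M : Multiset ℕ) : ℕ := (M.map fun a => (expand a).length).sum

/-- Pairs of a multiset of tokens and a set of positions, with the given statistics. -/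
structure IsTokenPair (n i j : ℕ) (p : Multiset ℕ × Finset ℕ) : Prop where
  zero : 0 ∉ p.1
  even : ∀ a, a % 2 = 0 → p.1.count a ≤ 1
  pos : 0 ∉ p.2
  size : (p.1.map fun a => (expand a).sum).sum + 4 * ∑ m ∈ p.2, m = n
  ones : p.1.countP (fun a => a % 4 = 0 ∨ a % 4 = 1) = i
  twos : p.1.countP (fun a => a % 4 = 1 ∨ a % 4 = 2) = j

/-- The token pairs that describe jagged overpartitions. -/
def boundedPairs (n i j : ℕ) : Set (Multiset ℕ × Finset ℕ) :=
  {p | IsTokenPair n i j p ∧ (∀ m ∈ p.2, m ≤ numParts p.1) ∧ (3 ∈ p.1 → numParts p.1 ∈ p.2)}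

/-- The token pairs that describe restricted overpartitions. -/
def freePairs (n i j : ℕ) : Set (Multiset ℕ × Finset ℕ) :=
  {p | IsTokenPair n i j p ∧ 3 ∉ p.1}

theorem countP_one_flatMap_expand (V : List ℕ) :
    (V.flatMap expand).countP (fun u => u % 4 = 1) =
      V.countP (fun a => a % 4 = 0 ∨ a % 4 = 1) := by
  induction V with
  | nil => rfl
  | cons a V ih =>
    rw [List.flatMap_cons, List.countP_append, ih, List.countP_cons, add_comm]
    congr 1
    have h4 : a % 4 = 3 ∨ a % 4 = 2 ∨ a % 4 = 1 ∨ a % 4 = 0 := by omega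
    rcases h4 with h | h | h | h
    · have h1 : (a - 3) % 4 = 0 := by omega
      simp [expand, h, h1]
    · simp [expand, h]
    · have h1 : (a + 1) % 4 = 2 := by omega
      simp [expand, h, h1]
    · have h1 : (a + 1) % 4 = 1 := by omega
      simp [expand, h, h1]

theorem countP_two_flatMap_expand (V : List ℕ) :
    (V.flatMap expand).countP (fun u => u % 4 = 2) =
      V.countP (fun a => a % 4 = 1 ∨ a % 4 = 2) := by
  induction V with
  | nil => rfl
  | cons a V ih =>
    rw [List.flatMap_cons, List.countP_append, ih, List.countP_cons, add_comm]
    congr 1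
    have h4 : a % 4 = 3 ∨ a % 4 = 2 ∨ a % 4 = 1 ∨ a % 4 = 0 := by omega
    rcases h4 with h | h | h | h
    · have h1 : (a - 3) % 4 = 0 := by omega
      simp [expand, h, h1]
    · simp [expand, h]
    · have h1 : (a + 1) % 4 = 2 := by omega
      simp [expand, h, h1]
    · have h1 : (a + 1) % 4 = 1 := by omega
      simp [expand, h, h1]

theorem sum_flatMap_expand (V : List ℕ) :
    (V.flatMap expand).sum = (V.map fun a => (expand a).sum).sum := by
  induction V with
  | nil => rfl
  | cons a V ih => simp [ih]

theorem countP_lift_mark (T : Finset ℕ) (U : List ℕ) (c : ℕ) :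
    (lift (mark T U)).countP (fun p => p.1 % 4 = c) = U.countP (fun u => u % 4 = c) := by
  rw [countP_mod_lift]
  conv_rhs => rw [← map_fst_mark T U]
  rw [List.countP_map]
  rfl

theorem lift_mark_mem_iff {V : List ℕ} (hV : V.IsChain TokRel) {T : Finset ℕ} (h0 : 0 ∉ T)
    (hT : ∀ m ∈ T, m ≤ (V.flatMap expand).length) {n i j : ℕ} :
    lift (mark T (V.flatMap expand)) ∈ jaggedSet n i j ↔ ((V : Multiset ℕ), T) ∈
      boundedPairs n i j := by
  have hlen : numParts (V : Multiset ℕ) = (V.flatMap expand).length := by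
    simp [numParts, List.length_flatMap]
  have hB : IsJagged (lift (mark T (V.flatMap expand))) ↔
      0 ∉ V ∧ (3 ∈ V → (V.flatMap expand).length ∈ T) := by
    rw [← zero_mem_flatMap_expand, ← getLast_flatMap_expand_ne_one hV]
    constructor
    · intro h
      exact (isBase_mark.1 (isBase_of_isJagged_lift h)).2.2
    · intro h
      exact isJagged_lift (isBase_mark.2
        ⟨fun u => mod_four_of_mem_flatMap_expand, isChain_flatMap_expand V hV, h⟩)
  have hc := fun a => count_le_one_of_isChain hV (a := a)
  simp only [jaggedSet, boundedPairs, Set.mem_ofPred_eq, hB, size_lift_mark hT, countP_lift_mark,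
    countP_one_flatMap_expand, countP_two_flatMap_expand, sum_flatMap_expand, hlen]
  constructor
  · rintro ⟨⟨h1, h2⟩, h3, h4, h5⟩
    exact ⟨⟨by simpa using h1, by simpa using hc, h0, by simpa using h3, by simpa using h4,
      by simpa using h5⟩, hT, by simpa using h2⟩
  · rintro ⟨⟨h1, -, -, h3, h4, h5⟩, -, h2⟩
    exact ⟨⟨by simpa using h1, by simpa using h2⟩, by simpa using h3, by simpa using h4,
      by simpa using h5⟩

/-- Sort, expand, overline, lift; each stage is undone in turn by `unlift`, reading off the
overlined positions, and `parse`. -/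
theorem ncard_boundedPairs (n i j : ℕ) : (boundedPairs n i j).ncard = (jaggedSet n i j).ncard := by
  have hlen : ∀ V : List ℕ, numParts (V : Multiset ℕ) = (V.flatMap expand).length := by
    simp [numParts, List.length_flatMap]
  have hb : ∀ p ∈ boundedPairs n i j, ∀ m ∈ p.2,
      m ≤ ((p.1.sort (· ≥ ·)).flatMap expand).length := by
    intro p hp m hm
    rw [← hlen, Multiset.sort_eq]
    exact hp.2.1 m hm
  refine Set.ncard_congr (fun p _ => lift (mark p.2 ((p.1.sort (· ≥ ·)).flatMap expand))) ?_ ?_ ?_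
  · intro p hp
    rw [lift_mark_mem_iff (isChain_sort hp.1.even) hp.1.pos (hb p hp), Multiset.sort_eq]
    exact hp
  · intro p q hp hq h
    have h1 := congrArg unlift h
    simp only [unlift_lift] at h1
    obtain ⟨h2, h3⟩ := mark_injective hp.1.pos hq.1.pos (hb p hp) (hb q hq) h1
    have h4 := congrArg parse h2
    rw [parse_flatMap_expand _ (isChain_sort hp.1.even),
      parse_flatMap_expand _ (isChain_sort hq.1.even)] at h4
    refine Prod.ext ?_ h3
    rw [← Multiset.sort_eq p.1 (· ≥ ·), h4, Multiset.sort_eq]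
  · intro l hl
    have h1 := lift_unlift_of_isJagged hl.1
    obtain ⟨T, ⟨h0, hT⟩, h2⟩ := exists_mark_eq (unlift l)
    have hbase := isBase_of_isJagged_lift (W := unlift l) (by rw [h1]; exact hl.1)
    rw [← h2, isBase_mark] at hbase
    have h3 := flatMap_expand_parse _ hbase.1
    have hV := isChain_parse _ hbase.1 hbase.2.1
    generalize parse ((unlift l).map Prod.fst) = V at *
    have hl' : lift (mark T (V.flatMap expand)) = l := by rw [h3, h2, h1]
    refine ⟨((V : Multiset ℕ), T), ?_, ?_⟩
    · rw [← lift_mark_mem_iff hV h0, hl']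
      · exact hl
      · rw [h3]
        simpa using hT
    · simp only
      rw [sort_coe_of_isChain hV, hl']

/-! ### Removing the zeros -/

theorem isTokenPair_add_replicate {n i j k : ℕ} {M : Multiset ℕ} {T : Finset ℕ} :
    IsTokenPair n i j (M + Multiset.replicate k 3, T) ↔ IsTokenPair n i j (M, T) := by
  have h0 : (0 : ℕ) ∉ Multiset.replicate k 3 := fun h => by
    have := Multiset.eq_of_mem_replicate h
    omega
  have hc : ∀ a, a % 2 = 0 → (Multiset.replicate k 3).count a = 0 := by
    intro a ha
    rw [Multiset.count_eq_zero]
    intro h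
    have := Multiset.eq_of_mem_replicate h
    omega
  have h1 : (Multiset.replicate k 3).countP (fun a => a % 4 = 0 ∨ a % 4 = 1) = 0 := by
    rw [Multiset.countP_eq_zero]
    intro a h
    have := Multiset.eq_of_mem_replicate h
    omega
  have h2 : (Multiset.replicate k 3).countP (fun a => a % 4 = 1 ∨ a % 4 = 2) = 0 := by
    rw [Multiset.countP_eq_zero]
    intro a h
    have := Multiset.eq_of_mem_replicate h
    omega
  have h3 : ((Multiset.replicate k 3).map fun a => (expand a).sum).sum = 0 := by
    simp [expand]
  constructor
  · rintro ⟨a1, a2, a3, a4, a5, a6⟩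
    simp only [Multiset.mem_add, not_or, Multiset.count_add, Multiset.map_add, Multiset.sum_add,
      Multiset.countP_add, h1, h2, h3, add_zero] at *
    exact ⟨a1.1, fun a ha => by simpa [hc a ha] using a2 a ha, a3, a4, a5, a6⟩
  · rintro ⟨a1, a2, a3, a4, a5, a6⟩
    refine ⟨?_, fun a ha => ?_, a3, ?_, ?_, ?_⟩ <;>
      simp only [Multiset.mem_add, not_or, Multiset.count_add, Multiset.map_add, Multiset.sum_add,
        Multiset.countP_add, h1, h2, h3, add_zero] at *
    · exact ⟨a1, h0⟩
    · rw [hc a ha]; exact a2 a ha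
    · exact a4
    · exact a5
    · exact a6

theorem numParts_add_replicate (k : ℕ) (M : Multiset ℕ) :
    numParts (M + Multiset.replicate k 3) = numParts M + k := by
  simp [numParts, expand]

theorem ncard_boundedPairs_eq_freePairs (n i j : ℕ) :
    (boundedPairs n i j).ncard = (freePairs n i j).ncard := by
  have hdec : ∀ M : Multiset ℕ, M.filter (· ≠ 3) + Multiset.replicate (M.count 3) 3 = M := by
    intro M
    rw [← Multiset.filter_eq', add_comm]
    exact Multiset.filter_add_not _ M
  refine Set.ncard_congr (fun p _ => (p.1.filter (· ≠ 3), p.2)) ?_ ?_ ?_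
  · rintro ⟨M, T⟩ ⟨h, -⟩
    rw [← hdec M, isTokenPair_add_replicate] at h
    exact ⟨h, by simp⟩
  -- If `k > k'`, then `k > 0` puts `numParts A + k` in `T`, beyond the bound `numParts A + k'`.
  · have key : ∀ (A : Multiset ℕ) (T : Finset ℕ) (k k' : ℕ),
        (A + Multiset.replicate k 3, T) ∈ boundedPairs n i j →
        (A + Multiset.replicate k' 3, T) ∈ boundedPairs n i j → k ≤ k' := by
      rintro A T k k' ⟨-, -, h1⟩ ⟨-, h2, -⟩
      by_contra hlt
      simp only [numParts_add_replicate] at h1 h2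
      have h3 : 3 ∈ A + Multiset.replicate k 3 :=
        Multiset.mem_add.2 (Or.inr (Multiset.mem_replicate.2 ⟨by omega, rfl⟩))
      have := h2 _ (h1 h3)
      omega
    rintro ⟨M, T⟩ ⟨M', T'⟩ h h' heq
    simp only [Prod.mk.injEq] at heq
    obtain ⟨h1, rfl⟩ := heq
    rw [← hdec M] at h ⊢
    rw [← hdec M', ← h1] at h' ⊢
    rw [le_antisymm (key _ _ _ _ h h') (key _ _ _ _ h' h)]
  · rintro ⟨A, T⟩ ⟨h, h3⟩
    simp only at h3
    have hsup : T.sup id ≠ 0 → T.sup id ∈ T := by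
      intro h0
      have hne : T.Nonempty := by
        rw [Finset.nonempty_iff_ne_empty]
        rintro rfl
        simp at h0
      obtain ⟨m, hm, h1⟩ := Finset.exists_mem_eq_sup T hne id
      rw [h1]
      exact hm
    -- Just enough zeros are added for the length to reach the largest position. Truncated
    -- subtraction gives none if the length suffices, and the supremum of the empty set is 0.
    refine ⟨(A + Multiset.replicate (T.sup id - numParts A) 3, T),
      ⟨isTokenPair_add_replicate.2 h, ?_, ?_⟩, ?_⟩
    · intro m hm
      have : m ≤ T.sup id := Finset.le_sup (f := id) hm
      simp only [numParts_add_replicate]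
      omega
    · intro hm
      simp only [Multiset.mem_add, h3, false_or, Multiset.mem_replicate] at hm
      simp only [numParts_add_replicate]
      have h4 : numParts A + (T.sup id - numParts A) = T.sup id := by omega
      rw [h4]
      exact hsup (by omega)
    · simp only [Prod.mk.injEq, and_true, Multiset.filter_add]
      rw [Multiset.filter_eq_self.2, Multiset.filter_eq_nil.2, add_zero]
      · intro a ha
        simp [Multiset.eq_of_mem_replicate ha]
      · rintro a ha rfl
        exact h3 ha

/-! ### Restricted overpartitions as multisets -/

/-- The multisets of parts of the restricted overpartitions. -/
structure IsRestrictedMultiset (n i j : ℕ) (N : Multiset (ℕ × Bool)) : Prop where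
  pos : ∀ p ∈ N, 0 < p.1
  count : ∀ m, N.count (m, true) ≤ 1
  overlined : ∀ p ∈ N, p.2 = true → p.1 % 4 ≠ 3
  no_one : (1, true) ∉ N
  nonOverlined : ∀ p ∈ N, p.2 = false → p.1 % 8 = 0 ∨ p.1 % 8 = 3 ∨ p.1 % 8 = 4
  size : (N.map Prod.fst).sum = n
  ones : N.countP (fun p => p.1 % 4 = 1 ∨ p.1 % 8 = 3) = i
  twos : N.countP (fun p => p.1 % 4 = 2 ∨ p.1 % 8 = 3) = j

/-- The order of the parts of an overpartition. -/
def OverRel (p p' : ℕ × Bool) : Prop := p'.1 ≤ p.1 ∧ (p.2 = true → p.1 ≠ p'.1)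

theorem isOverpartition_iff (l : OverSeq) :
    IsOverpartition l ↔ PosParts l ∧ l.Pairwise OverRel := by
  rw [IsOverpartition, OverlinedFinal, ← List.pairwise_and_iff]
  rfl

theorem count_le_one_of_pairwise {l : OverSeq} (h : l.Pairwise OverRel) (m : ℕ) :
    l.count (m, true) ≤ 1 := by
  induction l with
  | nil => simp
  | cons p l ih =>
    rw [List.pairwise_cons] at h
    by_cases hp : p = (m, true)
    · subst hp
      have : l.count (m, true) = 0 := by
        rw [List.count_eq_zero]
        intro hm
        exact (h.1 _ hm).2 rfl rfl
      simp [this]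
    · rw [List.count_cons_of_ne hp]
      exact ih h.2

theorem exists_pairwise_overRel {N : Multiset (ℕ × Bool)} (hN : ∀ m, N.count (m, true) ≤ 1) :
    ∃ l : OverSeq, l.Pairwise OverRel ∧ (l : Multiset (ℕ × Bool)) = N := by
  -- Overlined parts get even codes, just below the odd code of the same size, so `TokRel` on codes
  -- gives `OverRel` and `isChain_sort` applies again.
  let key : ℕ × Bool → ℕ := fun p => 2 * p.1 + (!p.2).toNat
  let dec : ℕ → ℕ × Bool := fun a => (a / 2, decide (a % 2 = 0))
  have hdk : ∀ p, dec (key p) = p := by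
    rintro ⟨m, _ | _⟩ <;> simp [dec, key]
    omega
  have hinj : Function.Injective key := Function.LeftInverse.injective hdk
  have hc : ∀ a, a % 2 = 0 → (N.map key).count a ≤ 1 := by
    intro a ha
    have h1 : a = key (a / 2, true) := by simp [key]; omega
    rw [h1, Multiset.count_map_eq_count' _ _ hinj]
    exact hN _
  have hs := isChain_sort hc
  rw [List.isChain_iff_pairwise] at hs
  refine ⟨((N.map key).sort (· ≥ ·)).map dec, ?_, ?_⟩
  · rw [List.pairwise_map]
    refine hs.imp fun {a b} h => ?_
    unfold TokRel at h
    simp only [OverRel, dec, decide_eq_true_eq]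
    omega
  · rw [← Multiset.map_coe, Multiset.sort_eq, Multiset.map_map]
    simp [hdk]

theorem mem_restrictedSet_iff {n i j : ℕ} {l : OverSeq} :
    l ∈ restrictedSet n i j ↔
      l.Pairwise OverRel ∧ IsRestrictedMultiset n i j (l : Multiset (ℕ × Bool)) := by
  constructor
  · rintro ⟨⟨h1, h2, h3, h4⟩, h5, h6, h7⟩
    rw [isOverpartition_iff] at h1
    exact ⟨h1.2, h1.1, fun m => by
        rw [Multiset.coe_count]
        convert count_le_one_of_pairwise h1.2 m,
      by simpa using h2, by simpa using h3, by simpa using h4, by simpa [size] using h5,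
      by simpa using h6, by simpa using h7⟩
  · rintro ⟨h, h1, -, h2, h3, h4, h5, h6, h7⟩
    exact ⟨⟨(isOverpartition_iff l).2 ⟨h1, h⟩, by simpa using h2,
      by simpa using h3, by simpa using h4⟩, by simpa [size] using h5, by simpa using h6,
      by simpa using h7⟩

theorem ncard_restrictedSet (n i j : ℕ) :
    (restrictedSet n i j).ncard = {N | IsRestrictedMultiset n i j N}.ncard := by
  refine Set.ncard_congr (fun l _ => (l : Multiset (ℕ × Bool))) ?_ ?_ ?_
  · intro l hl
    exact (mem_restrictedSet_iff.1 hl).2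
  · intro l l' hl hl' h
    refine (Multiset.coe_eq_coe.1 h).eq_of_pairwise (fun p q _ _ h1 h2 => ?_)
      (mem_restrictedSet_iff.1 hl).1 (mem_restrictedSet_iff.1 hl').1
    have h3 : p.1 = q.1 := le_antisymm h2.1 h1.1
    have h4 := fun hp => h1.2 hp h3
    have h5 := fun hq => h2.2 hq h3.symm
    exact Prod.ext h3 (by simp at h4 h5; rw [h4, h5])
  · intro N hN
    obtain ⟨l, hl, rfl⟩ := exists_pairwise_overRel hN.count
    exact ⟨l, mem_restrictedSet_iff.2 ⟨hl, hN⟩, rfl⟩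

/-! ### Token pairs as restricted overpartitions -/

/-- The part of a restricted overpartition encoded by a token. -/
def tokenPart (a : ℕ) : ℕ × Bool := ((expand a).sum, decide (a % 2 = 0))

theorem tokenPart_cases (a : ℕ) :
    (∃ k, a = 4 * k ∧ tokenPart a = (4 * k + 1, true)) ∨
    (∃ k, a = 4 * k + 1 ∧ tokenPart a = (8 * k + 3, false)) ∨
    (∃ k, a = 4 * k + 2 ∧ tokenPart a = (4 * k + 2, true)) ∨
    (∃ k, a = 4 * k + 3 ∧ tokenPart a = (4 * k, false)) := by
  have h4 : a % 4 = 0 ∨ a % 4 = 1 ∨ a % 4 = 2 ∨ a % 4 = 3 := by omega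
  rcases h4 with h | h | h | h
  · refine Or.inl ⟨a / 4, by omega, ?_⟩
    simp [tokenPart, expand, h]; omega
  · refine Or.inr (Or.inl ⟨a / 4, by omega, ?_⟩)
    simp [tokenPart, expand, h]; omega
  · refine Or.inr (Or.inr (Or.inl ⟨a / 4, by omega, ?_⟩))
    simp [tokenPart, expand, h]; omega
  · refine Or.inr (Or.inr (Or.inr ⟨a / 4, by omega, ?_⟩))
    simp [tokenPart, expand, h]; omega

theorem tokenPart_injective : Function.Injective tokenPart := by
  intro a b h
  rcases tokenPart_cases a with ⟨k, rfl, h1⟩ | ⟨k, rfl, h1⟩ | ⟨k, rfl, h1⟩ | ⟨k, rfl, h1⟩ <;>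
  rcases tokenPart_cases b with ⟨m, rfl, h2⟩ | ⟨m, rfl, h2⟩ | ⟨m, rfl, h2⟩ | ⟨m, rfl, h2⟩ <;>
  rw [h1, h2] at h <;> simp at h <;> omega

/-- The multiset of parts encoded by a token pair. -/
def pairParts (p : Multiset ℕ × Finset ℕ) : Multiset (ℕ × Bool) :=
  p.1.map tokenPart + p.2.val.map fun m => (4 * m, true)

theorem overlinedFour_injective : Function.Injective fun m : ℕ => (4 * m, true) := by
  intro a b h
  simpa using h

/-- No token encodes an overlined multiple of 4, so the two summands of `pairParts` do not interfere
and both can be recovered from multiplicities. -/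
theorem count_pairParts_token (M : Multiset ℕ) (T : Finset ℕ) (a : ℕ) :
    (pairParts (M, T)).count (tokenPart a) = M.count a := by
  rw [pairParts, Multiset.count_add, Multiset.count_map_eq_count' _ _ tokenPart_injective,
    Nat.add_eq_left, Multiset.count_eq_zero]
  intro h
  rw [Multiset.mem_map] at h
  obtain ⟨m, -, h⟩ := h
  rcases tokenPart_cases a with ⟨k, rfl, h1⟩ | ⟨k, rfl, h1⟩ | ⟨k, rfl, h1⟩ | ⟨k, rfl, h1⟩ <;>
    rw [h1] at h <;> simp at h <;> omega

theorem count_pairParts_four (M : Multiset ℕ) (T : Finset ℕ) (m : ℕ) :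
    (pairParts (M, T)).count (4 * m, true) = T.val.count m := by
  rw [pairParts, Multiset.count_add,
    Multiset.count_map_eq_count' (fun m => (4 * m, true)) _ overlinedFour_injective,
    Multiset.count_eq_zero.2, zero_add]
  intro h
  rw [Multiset.mem_map] at h
  obtain ⟨a, -, h⟩ := h
  rcases tokenPart_cases a with ⟨k, rfl, h1⟩ | ⟨k, rfl, h1⟩ | ⟨k, rfl, h1⟩ | ⟨k, rfl, h1⟩ <;>
    rw [h1] at h <;> simp at h <;> omega

theorem pairParts_injective : Function.Injective pairParts := by
  rintro ⟨M, T⟩ ⟨M', T'⟩ h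
  refine Prod.ext ?_ (Finset.val_injective ?_)
  · ext a
    simp only
    rw [← count_pairParts_token M T, h, count_pairParts_token]
  · ext m
    simp only
    rw [← count_pairParts_four M T, h, count_pairParts_four]

/-- Even tokens are exactly those giving overlined parts, so the repetition rules agree. Token 0 is
the part `(1, true)`; token 3 and position 0 would give parts of size 0. -/
theorem isRestrictedMultiset_pairParts_iff {n i j : ℕ} {p : Multiset ℕ × Finset ℕ} :
    IsRestrictedMultiset n i j (pairParts p) ↔ p ∈ freePairs n i j := by
  obtain ⟨M, T⟩ := p
  have hall : ∀ P : ℕ × Bool → Prop, (∀ q ∈ pairParts (M, T), P q) ↔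
      (∀ a ∈ M, P (tokenPart a)) ∧ ∀ m ∈ T, P (4 * m, true) := by
    intro P
    simp only [pairParts, Multiset.mem_add, or_imp, forall_and, Multiset.forall_mem_map_iff]
    rfl
  have hsize : ((pairParts (M, T)).map Prod.fst).sum =
      (M.map fun a => (expand a).sum).sum + 4 * ∑ m ∈ T, m := by
    rw [pairParts, Multiset.map_add, Multiset.sum_add, Multiset.map_map, Multiset.map_map,
      Finset.mul_sum]
    rfl
  have hones : (pairParts (M, T)).countP (fun p => p.1 % 4 = 1 ∨ p.1 % 8 = 3) =
      M.countP (fun a => a % 4 = 0 ∨ a % 4 = 1) := by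
    rw [pairParts, Multiset.countP_add, Multiset.countP_eq_zero (s := T.val.map _) |>.2, add_zero,
      Multiset.countP_map, ← Multiset.countP_eq_card_filter]
    · refine Multiset.countP_congr rfl fun a _ => ?_
      rcases tokenPart_cases a with ⟨k, rfl, h⟩ | ⟨k, rfl, h⟩ | ⟨k, rfl, h⟩ | ⟨k, rfl, h⟩ <;>
        rw [h] <;> simp only [eq_iff_iff] <;> omega
    · intro q hq
      obtain ⟨m, -, rfl⟩ := Multiset.mem_map.1 hq
      simp only
      omega
  have htwos : (pairParts (M, T)).countP (fun p => p.1 % 4 = 2 ∨ p.1 % 8 = 3) =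
      M.countP (fun a => a % 4 = 1 ∨ a % 4 = 2) := by
    rw [pairParts, Multiset.countP_add, Multiset.countP_eq_zero (s := T.val.map _) |>.2, add_zero,
      Multiset.countP_map, ← Multiset.countP_eq_card_filter]
    · refine Multiset.countP_congr rfl fun a _ => ?_
      rcases tokenPart_cases a with ⟨k, rfl, h⟩ | ⟨k, rfl, h⟩ | ⟨k, rfl, h⟩ | ⟨k, rfl, h⟩ <;>
        rw [h] <;> simp only [eq_iff_iff] <;> omega
    · intro q hq
      obtain ⟨m, -, rfl⟩ := Multiset.mem_map.1 hq
      simp only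
      omega
  have hone : (1, true) ∉ pairParts (M, T) ↔ 0 ∉ M := by
    have h := count_pairParts_token M T 0
    rw [show tokenPart 0 = (1, true) from rfl] at h
    rw [← Multiset.count_eq_zero, h, Multiset.count_eq_zero]
  constructor
  · rintro ⟨h1, h2, -, h4, -, h6, h7, h8⟩
    rw [hall] at h1
    refine ⟨⟨hone.1 h4, fun a ha => ?_, fun h0 => ?_, hsize ▸ h6, hones ▸ h7, htwos ▸ h8⟩,
      fun h3 => ?_⟩
    · have h9 : tokenPart a = ((tokenPart a).1, true) := by simp [tokenPart, ha]
      rw [← count_pairParts_token M T, h9]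
      exact h2 _
    · simpa using h1.2 0 h0
    · simpa [tokenPart, expand] using h1.1 3 h3
  · rintro ⟨⟨h1, h2, h3, h4, h5, h6⟩, h7⟩
    refine ⟨?_, fun m => ?_, ?_, hone.2 h1, ?_, hsize.trans h4, hones.trans h5, htwos.trans h6⟩
    · rw [hall]
      refine ⟨fun a ha => ?_, fun m hm => ?_⟩
      · have ha3 : a ≠ 3 := by rintro rfl; exact h7 ha
        rcases tokenPart_cases a with ⟨k, rfl, h⟩ | ⟨k, rfl, h⟩ | ⟨k, rfl, h⟩ | ⟨k, rfl, h⟩ <;>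
          rw [h] <;> simp only <;> omega
      · have hm0 : m ≠ 0 := by rintro rfl; exact h3 hm
        simp only
        omega
    · by_cases hm : (m, true) ∈ pairParts (M, T)
      · rw [pairParts, Multiset.mem_add, Multiset.mem_map, Multiset.mem_map] at hm
        rcases hm with ⟨a, -, h⟩ | ⟨k, -, h⟩
        · rw [← h, count_pairParts_token]
          apply h2
          simpa [tokenPart] using congrArg Prod.snd h
        · rw [← h, count_pairParts_four]
          exact Multiset.nodup_iff_count_le_one.1 T.nodup k
      · rw [Multiset.count_eq_zero.2 hm]
        exact zero_le_one
    · rw [hall]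
      refine ⟨fun a ha => ?_, fun m hm => ?_⟩
      · rcases tokenPart_cases a with ⟨k, rfl, h⟩ | ⟨k, rfl, h⟩ | ⟨k, rfl, h⟩ | ⟨k, rfl, h⟩ <;>
          rw [h] <;> simp
      · simp only
        omega
    · rw [hall]
      refine ⟨fun a ha => ?_, fun m hm => by simp⟩
      rcases tokenPart_cases a with ⟨k, rfl, h⟩ | ⟨k, rfl, h⟩ | ⟨k, rfl, h⟩ | ⟨k, rfl, h⟩ <;>
        rw [h] <;> simp
      all_goals omega

theorem exists_multiset_map_eq {α β : Type*} {f : α → β} (s : Multiset β)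
    (h : ∀ b ∈ s, ∃ a, f a = b) : ∃ t : Multiset α, t.map f = s := by
  induction s using Multiset.induction with
  | empty => exact ⟨0, rfl⟩
  | cons b s ih =>
    obtain ⟨t, rfl⟩ := ih fun c hc => h c (Multiset.mem_cons_of_mem hc)
    obtain ⟨a, rfl⟩ := h b (Multiset.mem_cons_self _ _)
    exact ⟨a ::ₘ t, Multiset.map_cons _ _ _⟩

theorem exists_pairParts_eq {n i j : ℕ} {N : Multiset (ℕ × Bool)}
    (hN : IsRestrictedMultiset n i j N) : ∃ p, pairParts p = N := by
  -- Overlined multiples of 4 come from the position set; every other part is the image of a token.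
  let P : ℕ × Bool → Prop := fun q => q.1 % 4 = 0 ∧ q.2 = true
  obtain ⟨M, hM⟩ := exists_multiset_map_eq (f := tokenPart) (N.filter fun q => ¬ P q) (by
    rintro ⟨m, b⟩ hq
    obtain ⟨hq, hP⟩ := Multiset.mem_filter.1 hq
    have h1 := hN.overlined _ hq
    have h2 := hN.nonOverlined _ hq
    simp only [P] at h1 h2 hP
    rcases b with _ | _
    · rcases h2 rfl with h | h | h
      · exact ⟨m + 3, by simp [tokenPart, expand, show (m + 3) % 4 = 3 by omega]; omega⟩
      · exact ⟨4 * (m / 8) + 1, by simp [tokenPart, expand]; omega⟩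
      · exact ⟨m + 3, by simp [tokenPart, expand, show (m + 3) % 4 = 3 by omega]; omega⟩
    · have h3 : m % 4 = 1 ∨ m % 4 = 2 := by
        have := h1 rfl
        simp only [and_true] at hP
        omega
      rcases h3 with h | h
      · refine ⟨m - 1, ?_⟩
        have h5 : (m - 1) % 4 = 0 := by omega
        simp [tokenPart, expand, h5]
        omega
      · exact ⟨m, by simp [tokenPart, expand, h]; omega⟩)
  obtain ⟨T, hT⟩ := exists_multiset_map_eq (f := fun m : ℕ => (4 * m, true)) (N.filter P) (by
    rintro ⟨m, b⟩ hq
    obtain ⟨-, h1, h2⟩ := Multiset.mem_filter.1 hq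
    refine ⟨m / 4, ?_⟩
    simp only at h1 h2
    rw [h2, Nat.mul_div_cancel' (Nat.dvd_of_mod_eq_zero h1)])
  have hnd : T.Nodup := by
    rw [Multiset.nodup_iff_count_le_one]
    intro m
    rw [← Multiset.count_map_eq_count' (fun m : ℕ => (4 * m, true)) _ overlinedFour_injective, hT]
    exact (Multiset.count_le_of_le _ (Multiset.filter_le _ _)).trans (hN.count _)
  refine ⟨(M, ⟨T, hnd⟩), ?_⟩
  rw [pairParts, hM, hT, add_comm]
  exact Multiset.filter_add_not P N

theorem ncard_freePairs (n i j : ℕ) :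
    (freePairs n i j).ncard = {N | IsRestrictedMultiset n i j N}.ncard := by
  refine Set.ncard_congr (fun p _ => pairParts p) ?_ ?_ ?_
  · intro p hp
    exact isRestrictedMultiset_pairParts_iff.2 hp
  · intro p q _ _ h
    exact pairParts_injective h
  · intro N hN
    obtain ⟨p, rfl⟩ := exists_pairParts_eq hN
    exact ⟨p, isRestrictedMultiset_pairParts_iff.1 hN, rfl⟩

end OverSeq

theorem mainTheorem8 (n i j : ℕ) :
    OverSeq.jaggedCount n i j = OverSeq.restrictedCount n i j := by
  rw [OverSeq.jaggedCount, OverSeq.restrictedCount, ← OverSeq.ncard_boundedPairs,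
    OverSeq.ncard_boundedPairs_eq_freePairs, OverSeq.ncard_freePairs,
    ← OverSeq.ncard_restrictedSet]
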